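/- **Setting (syntax).** Fix a set $\mathbf{Base}$ of base types, basic operators $\mathbf{op}:\sigma\rightarrowtriangle\tau$ (with arity $\mathrm{ar}(\mathbf{op})=\sigma$ and coarity $\mathrm{car}(\mathbf{op})=\tau$ arbitrary simple types), and atomic predicates $\mathbf{ap}:\sigma_1\times\dots\times\sigma_n$ with $\sigma_i\in\mathbf{Base}\cup\{\mathbf{Prop}\}$, among which are always $\le_{\mathbf{Prop}}$ and the equalities $=_\tau$ for $\tau\in\mathbf{Base}\cup\{\mathbf{Prop}\}$. Finite products are nested to the right; the product is $\sigma_1$ for $n=1$ and $1$ for $n=0$. * Simple types: $\sigma::=\mathbf{Prop}\mid b\mid 1\mid\sigma\times\sigma\mid 0\mid\sigma+\sigma\mid\sigma\to\mathbf{Prop}$. * Terms: variables, $\mathbf{op}(M)$, $()$, pairs, projections, $\delta(M)$ (elimination of $0$), $\iota_i\,M$, case analysis, abstractions $\lambda x.M:\sigma\to\mathbf{Prop}$ with $M:\mathbf{Prop}$, applications, and fixed points $\mathbf{fix}\,f.M$ at types $\sigma\to\mathbf{Prop}$, with the usual simple typing. For $\mathbf{op}:1\rightarrowtriangle\tau$,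 write $\mathbf{op}$ for $\mathbf{op}(())$. * Formulas: $\phi::=\mathbf{ap}(M)\mid\top\mid\bot\mid\phi\Rightarrow\phi\mid\phi\wedge\phi\mid\phi\vee\phi$. * Refinement types: $\dot\sigma::=\{v:\tau\mid\phi\}$ (with $\tau\in\mathbf{Base}\cup\{\mathbf{Prop},1\}$) $\mid(x:\dot\sigma)\times\dot\tau\mid 0\mid\dot\sigma+\dot\tau\mid(x:\dot\sigma)\to\{v:\mathbf{Prop}\mid\phi\}$; $|\dot\sigma|$ is the underlying simple type. A refinement context $\dot\Gamma$ is a list of variables with refinement types, with underlying context $|\dot\Gamma|$. Write $\{(v_1,\dots,v_n):\sigma_1\times\dots\times\sigma_n\mid\phi\}$ for $(v_1:\{v_1:\sigma_1\mid\top\})\times\dots\times\{v_n:\sigma_n\mid\phi\}$ (for $n=0$: $\{v:1\mid\phi\}$). All types, contexts and terms are assumed well formed, resp. simply typed with the underlying type. **Setting (semantics).** A $\lambda_{\mathrm{HFL}}$-model $\mathcal A$ consists of an $\omega$CPO-enriched bicartesian closed category $\mathbb C$ (hom-sets are $\omega$cpos, composition is Scott-continuous, and the bijections defining products, coproducts and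 exponentials are isomorphisms of $\omega$cpos) that admits a lifting strong monad, i.e. free algebras for the theory with one constant $\bot$ and the inequation $\bot\le x$ exist and the induced monad is strong; objects interpreting the base types; an object $\Omega$ interpreting $\mathbf{Prop}$ with a bottom element $\bot:1\to\Omega$; and a morphism $a(\mathbf{op}):[\![\mathrm{ar}(\mathbf{op})]\!]\to[\![\mathrm{car}(\mathbf{op})]\!]$ for each basic operator. Types and terms are interpreted in the standard way, $[\![\mathbf{fix}\,f.M]\!]$ being the supremum of the iterates of $[\![M]\!]$ from $\bot$. Fix moreover a subset of $\mathbb C(1,[\![\sigma]\!])$ for each atomic predicate $\mathbf{ap}:\sigma$, where $\le_{\mathbf{Prop}}$ is interpreted by the order of $\mathbb C(1,\Omega)$ and $=_\tau$ by equality. A formula $\Gamma\vdash\phi$ is interpreted as a subset $[\![\Gamma\vdash\phi]\!]\subseteq\mathbb C(1,[\![\Gamma]\!])$, with $\gamma \in[\![\mathbf{ap}(M)]\!]$ iff $[\![M]\!]\circ\gamma \in[\![\mathbf{ap}]\!]$ and the connectives interpreted as in the Boolean algebra of subsets. Refinement contexts are interpreted as subsets $[\![\dot\Gamma]\!]\subseteq\mathbb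 C(1,[\![|\dot\Gamma|]\!])$: $[\![\cdot]\!]=\mathbb C(1,1)$, and, for $\gamma \in\mathbb C(1,[\![|\dot\Gamma|]\!])$ and $a\in\mathbb C(1,[\![|\dot\sigma|]\!])$, $\langle\gamma ,a\rangle\in[\![\dot\Gamma,v:\dot\sigma]\!]$ iff * $\dot\sigma=\{v:\tau\mid\phi\}$: $\gamma \in[\![\dot\Gamma]\!]$ and $\langle\gamma ,a\rangle\in[\![|\dot\Gamma|,v:\tau\vdash\phi]\!]$; * $\dot\sigma=(x:\dot\sigma_1)\times\dot\sigma_2$: $\langle\langle\gamma ,\pi_1 a\rangle,\pi_2 a\rangle\in[\![\dot\Gamma,x:\dot\sigma_1,v:\dot\sigma_2]\!]$; * $\dot\sigma=0$: never; * $\dot\sigma=\dot\sigma_1+\dot\sigma_2$: $a=\iota_i\circ a'$ with $\langle\gamma ,a'\rangle\in[\![\dot\Gamma,v:\dot\sigma_i]\!]$ for some $i$ and $a'$; * $\dot\sigma=(x:\dot\sigma_1)\to\{v:\mathbf{Prop}\mid\phi\}$: $\gamma \in[\![\dot\Gamma]\!]$, and for every $a'$ with $\langle\gamma ,a'\rangle\in[\![\dot\Gamma,x:\dot\sigma_1]\!]$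 one has $\langle\langle\gamma ,a'\rangle,\mathrm{ev}\circ\langle a,a'\rangle\rangle\in[\![|\dot\Gamma|,x:|\dot\sigma_1|,v:\mathbf{Prop}\vdash\phi]\!]$. A judgement $\dot\Gamma\vdash M:\dot\sigma$ is *valid* if $\langle\gamma ,[\![M]\!]\circ\gamma \rangle\in[\![\dot\Gamma,v:\dot\sigma]\!]$ for all $\gamma \in[\![\dot\Gamma]\!]$. A typing rule is *sound* if, whenever its side conditions hold and its premises that are judgements are valid, its conclusion is valid. **Proposition.** In every $\lambda_{\mathrm{HFL}}$-model, the following three rules are sound. * (R-BasicConst) For $\mathbf{op}:1\rightarrowtriangle\tau$ with $\tau\in\mathbf{Base}\cup\{\mathbf{Prop}\}$: $$\dot\Gamma\vdash\mathbf{op}:\{v:\tau\mid v=_\tau\mathbf{op}\}.$$ * (R-BasicSimp) For $\mathbf{op}:\sigma_1\times\dots\times\sigma_n\rightarrowtriangle\tau$ with $\sigma_1,\dots,\sigma_n,\tau\in\mathbf{Base}\cup\{\mathbf{Prop}\}$: $$\text{if }\dot\Gamma\vdash M:\{(v_1,\dots,v_n):\sigma_1\times\dots\times\sigma_n\mid\phi[\mathbf{op}(v_1,\dots,v_n)/v]\}\text{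 then }\dot\Gamma\vdash\mathbf{op}(M):\{v:\tau\mid\phi\}.$$ * (R-BasicBool) For $\mathbf{op}:\sigma_1\times\dots\times\sigma_n\rightarrowtriangle 1+1$ with $\sigma_1,\dots,\sigma_n\in\mathbf{Base}\cup\{\mathbf{Prop}\}$, and formulas $v_1:\sigma_1,\dots,v_n:\sigma_n\vdash\psi_t,\psi_f$ such that $a(\mathbf{op})(\gamma )=\iota_1()$ for all $\gamma \in[\![\psi_t]\!]$ and $a(\mathbf{op})(\gamma )=\iota_2()$ for all $\gamma \in[\![\psi_f]\!]$: $$\text{if }\dot\Gamma\vdash M:\{(v_1,\dots,v_n):\sigma_1\times\dots\times\sigma_n\mid\psi_t\wedge\phi_t[()/v]\vee\psi_f\wedge\phi_f[()/v]\}\text{ then }\dot\Gamma\vdash\mathbf{op}(M):\{v:1\mid\phi_t\}+\{v:1\mid\phi_f\}.$$ Moreover each of them is an instance of the general rule (R-BasicOp): $$\text{if }\dot\Gamma\vdash M:\dot\sigma,\ \mathrm{ar}(\mathbf{op})=|\dot\sigma|,\ \mathrm{car}(\mathbf{op})=|\dot\tau|,\text{ and }(\mathrm{id}\times a(\mathbf{op}))\circ\gamma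 \in[\![\dot\Gamma,v:\dot\tau]\!]\text{ for all }\gamma \in[\![\dot\Gamma,v:\dot\sigma]\!],\text{ then }\dot\Gamma\vdash\mathbf{op}(M):\dot\tau.$$ That is, every family of judgements closed under (R-BasicOp) is closed under (R-BasicSimp) and (R-BasicBool), and it is closed under (R-BasicConst) if it also contains all judgements $\dot\Gamma\vdash():\{v:1\mid\top\}$. -/

import Mathlib

open CategoryTheory CategoryTheory.Limits MonoidalCategory CartesianMonoidalCategory

universe u v w₁ w₂ w₃

namespace LambdaHFL

/-! ### Simple types, terms and formulas

Syntax is well-scoped and well-typed by construction: variables are de Bruijn indices, a context is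
the list of its types with the most recently bound variable first, and an element of `Tm S Γ τ` is
a well-typed term `Γ ⊢ M : τ`. -/

/-- Simple types over a set `B` of base types; `fn σ` is the function type `σ → Prop`. -/
inductive Ty (B : Type w₁) : Type w₁
  | prop : Ty B
  | base : B → Ty B
  | unit : Ty B
  | prod : Ty B → Ty B → Ty B
  | zero : Ty B
  | sum : Ty B → Ty B → Ty B
  | fn : Ty B → Ty B

/-- The set `Base ∪ {Prop}`. -/
inductive Ground (B : Type w₁) : Type w₁
  | base : B → Ground B
  | prop : Ground B

def Ground.toTy {B : Type w₁} : Ground B → Ty B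
  | .base b => .base b
  | .prop => .prop

/-- The set `Base ∪ {Prop, 1}` of types that can be refined by a formula. -/
inductive Prim (B : Type w₁) : Type w₁
  | ground : Ground B → Prim B
  | unit : Prim B

def Prim.toTy {B : Type w₁} : Prim B → Ty B
  | .ground g => g.toTy
  | .unit => .unit

/-- The finite product `σ₁ × (σ₂ × (⋯ × σₙ))`; it is `σ₁` if `n = 1` and `1` if `n = 0`. -/
def prodTy {B : Type w₁} : List (Ground B) → Ty B
  | [] => .unit
  | [g] => g.toTy
  | g :: h :: l => .prod g.toTy (prodTy (h :: l))

/-- The parameters of the syntax: base types, basic operators `op : σ ⇸ τ` sorted by arity and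
coarity, and the atomic predicates (other than equality and `≤_Prop`, which are always present)
sorted by their arity `σ₁ × ⋯ × σₙ`. -/
structure Signature where
  Base : Type w₁
  Op : Ty Base → Ty Base → Type w₂
  Pred : List (Ground Base) → Type w₃

abbrev Ctx (B : Type w₁) := List (Ty B)

inductive Var {B : Type w₁} : Ctx B → Ty B → Type w₁
  | zero {Γ : Ctx B} {τ : Ty B} : Var (τ :: Γ) τ
  | succ {Γ : Ctx B} {σ τ : Ty B} : Var Γ τ → Var (σ :: Γ) τ

inductive Tm (S : Signature.{w₁, w₂, w₃}) : Ctx S.Base → Ty S.Base → Type (max w₁ w₂)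
  | var {Γ τ} : Var Γ τ → Tm S Γ τ
  | op {Γ σ τ} : S.Op σ τ → Tm S Γ σ → Tm S Γ τ
  | unit {Γ} : Tm S Γ .unit
  | pair {Γ σ τ} : Tm S Γ σ → Tm S Γ τ → Tm S Γ (.prod σ τ)
  | fst {Γ σ τ} : Tm S Γ (.prod σ τ) → Tm S Γ σ
  | snd {Γ σ τ} : Tm S Γ (.prod σ τ) → Tm S Γ τ
  | absurd {Γ τ} : Tm S Γ .zero → Tm S Γ τ
  | inl {Γ σ τ} : Tm S Γ σ → Tm S Γ (.sum σ τ)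
  | inr {Γ σ τ} : Tm S Γ τ → Tm S Γ (.sum σ τ)
  | case {Γ σ₁ σ₂ τ} : Tm S Γ (.sum σ₁ σ₂) → Tm S (σ₁ :: Γ) τ → Tm S (σ₂ :: Γ) τ → Tm S Γ τ
  | lam {Γ σ} : Tm S (σ :: Γ) .prop → Tm S Γ (.fn σ)
  | app {Γ σ} : Tm S Γ (.fn σ) → Tm S Γ σ → Tm S Γ .prop
  | fix {Γ σ} : Tm S (.fn σ :: Γ) (.fn σ) → Tm S Γ (.fn σ)

/-- The atomic predicates: `≤_Prop`, the equalities `=_τ` for `τ ∈ Base ∪ {Prop}`, and those of the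
signature. -/
inductive Atom (S : Signature.{w₁, w₂, w₃}) : List (Ground S.Base) → Type (max w₁ w₃)
  | le : Atom S [.prop, .prop]
  | eq (g : Ground S.Base) : Atom S [g, g]
  | pred {gs} : S.Pred gs → Atom S gs

/-- Well-formed formulas `Γ ⊢ φ`. -/
inductive Fml (S : Signature.{w₁, w₂, w₃}) : Ctx S.Base → Type (max w₁ w₂ w₃)
  | atom {Γ gs} : Atom S gs → Tm S Γ (prodTy gs) → Fml S Γ
  | top {Γ} : Fml S Γ
  | bot {Γ} : Fml S Γ
  | imp {Γ} : Fml S Γ → Fml S Γ → Fml S Γ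
  | and {Γ} : Fml S Γ → Fml S Γ → Fml S Γ
  | or {Γ} : Fml S Γ → Fml S Γ → Fml S Γ

/-! ### Renaming and substitution -/

def Ren {B : Type w₁} (Γ Δ : Ctx B) := ∀ ⦃τ : Ty B⦄, Var Γ τ → Var Δ τ

def Ren.lift {B : Type w₁} {Γ Δ : Ctx B} (ρ : Ren Γ Δ) (σ : Ty B) : Ren (σ :: Γ) (σ :: Δ) :=
  fun _ x => match x with
    | .zero => .zero
    | .succ y => .succ (ρ y)

def Tm.rename {S : Signature.{w₁, w₂, w₃}} {Γ : Ctx S.Base} {τ : Ty S.Base} :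
    Tm S Γ τ → ∀ {Δ : Ctx S.Base}, Ren Γ Δ → Tm S Δ τ
  | .var x, _, ρ => .var (ρ x)
  | .op o M, _, ρ => .op o (M.rename ρ)
  | .unit, _, _ => .unit
  | .pair M N, _, ρ => .pair (M.rename ρ) (N.rename ρ)
  | .fst M, _, ρ => .fst (M.rename ρ)
  | .snd M, _, ρ => .snd (M.rename ρ)
  | .absurd M, _, ρ => .absurd (M.rename ρ)
  | .inl M, _, ρ => .inl (M.rename ρ)
  | .inr M, _, ρ => .inr (M.rename ρ)
  | .case M N₁ N₂, _, ρ => .case (M.rename ρ) (N₁.rename (ρ.lift _)) (N₂.rename (ρ.lift _))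
  | .lam M, _, ρ => .lam (M.rename (ρ.lift _))
  | .app M N, _, ρ => .app (M.rename ρ) (N.rename ρ)
  | .fix M, _, ρ => .fix (M.rename (ρ.lift _))

/-- Simultaneous substitutions of terms over `Δ` for the variables of `Γ`. -/
def Sub (S : Signature.{w₁, w₂, w₃}) (Γ Δ : Ctx S.Base) := ∀ ⦃τ : Ty S.Base⦄, Var Γ τ → Tm S Δ τ

def Sub.lift {S : Signature.{w₁, w₂, w₃}} {Γ Δ : Ctx S.Base} (s : Sub S Γ Δ) (σ : Ty S.Base) :
    Sub S (σ :: Γ) (σ :: Δ) :=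
  fun _ x => match x with
    | .zero => .var .zero
    | .succ y => (s y).rename (fun _ z => .succ z)

def Tm.subst {S : Signature.{w₁, w₂, w₃}} {Γ : Ctx S.Base} {τ : Ty S.Base} :
    Tm S Γ τ → ∀ {Δ : Ctx S.Base}, Sub S Γ Δ → Tm S Δ τ
  | .var x, _, s => s x
  | .op o M, _, s => .op o (M.subst s)
  | .unit, _, _ => .unit
  | .pair M N, _, s => .pair (M.subst s) (N.subst s)
  | .fst M, _, s => .fst (M.subst s)
  | .snd M, _, s => .snd (M.subst s)
  | .absurd M, _, s => .absurd (M.subst s)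
  | .inl M, _, s => .inl (M.subst s)
  | .inr M, _, s => .inr (M.subst s)
  | .case M N₁ N₂, _, s => .case (M.subst s) (N₁.subst (s.lift _)) (N₂.subst (s.lift _))
  | .lam M, _, s => .lam (M.subst (s.lift _))
  | .app M N, _, s => .app (M.subst s) (N.subst s)
  | .fix M, _, s => .fix (M.subst (s.lift _))

def Fml.subst {S : Signature.{w₁, w₂, w₃}} {Γ Δ : Ctx S.Base} (s : Sub S Γ Δ) :
    Fml S Γ → Fml S Δ
  | .atom a M => .atom a (M.subst s)
  | .top => .top
  | .bot => .bot
  | .imp φ ψ => .imp (φ.subst s) (ψ.subst s)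
  | .and φ ψ => .and (φ.subst s) (ψ.subst s)
  | .or φ ψ => .or (φ.subst s) (ψ.subst s)

/-- Renaming of variables in a formula, in particular weakening. -/
def Fml.rename {S : Signature.{w₁, w₂, w₃}} {Γ Δ : Ctx S.Base} (ρ : Ren Γ Δ) (φ : Fml S Γ) :
    Fml S Δ :=
  φ.subst (fun _ x => .var (ρ x))

/-! ### Tuples of variables -/

/-- The context `Γ, v₁ : σ₁, …, vₙ : σₙ`. -/
def extend {B : Type w₁} (Γ : Ctx B) : List (Ground B) → Ctx B
  | [] => Γ
  | g :: l => extend (g.toTy :: Γ) l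

/-- The inclusion of `Γ` in `Γ, v₁ : σ₁, …, vₙ : σₙ`. -/
def weaken {B : Type w₁} : ∀ {Γ : Ctx B} (gs : List (Ground B)), Ren Γ (extend Γ gs)
  | _, [], _, x => x
  | _, _ :: l, _, x => weaken l (.succ x)

/-- The renaming `Γ, v₁ : σ₁, …, vₙ : σₙ → Δ, v₁ : σ₁, …, vₙ : σₙ` extending a renaming `Γ → Δ`. -/
def Ren.liftAll {B : Type w₁} :
    ∀ {Γ Δ : Ctx B} (_ : Ren Γ Δ) (gs : List (Ground B)), Ren (extend Γ gs) (extend Δ gs)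
  | _, _, ρ, [] => ρ
  | _, _, ρ, g :: l => (ρ.lift g.toTy).liftAll l

/-- The inclusion of `v₁ : σ₁, …, vₙ : σₙ` in `Γ, v₁ : σ₁, …, vₙ : σₙ`. -/
def fromClosed {B : Type w₁} (Γ : Ctx B) (gs : List (Ground B)) :
    Ren (extend [] gs) (extend Γ gs) :=
  Ren.liftAll (fun _ x => by cases x) gs

/-- The tuple `Γ, v₁ : σ₁, …, vₙ : σₙ ⊢ (v₁, …, vₙ) : σ₁ × ⋯ × σₙ`. -/
def tupleVars {S : Signature.{w₁, w₂, w₃}} :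
    ∀ (Γ : Ctx S.Base) (gs : List (Ground S.Base)), Tm S (extend Γ gs) (prodTy gs)
  | _, [] => .unit
  | _, [_] => .var .zero
  | Γ, g :: h :: l => .pair (.var (weaken (h :: l) .zero)) (tupleVars (g.toTy :: Γ) (h :: l))

/-- The substitution `[M / v]` from `Γ, v : τ` to `Γ, v₁ : σ₁, …, vₙ : σₙ`, for a term
`Γ, v₁ : σ₁, …, vₙ : σₙ ⊢ M : τ`. -/
def Sub.inst {S : Signature.{w₁, w₂, w₃}} {Γ : Ctx S.Base} {τ : Ty S.Base}
    (gs : List (Ground S.Base)) (M : Tm S (extend Γ gs) τ) : Sub S (τ :: Γ) (extend Γ gs)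
  | _, .zero => M
  | _, .succ y => .var (weaken gs y)

/-- The formula `Γ, v₁ : σ₁, …, vₙ : σₙ ⊢ φ[M / v]` obtained from `Γ, v : τ ⊢ φ`. -/
def Fml.inst {S : Signature.{w₁, w₂, w₃}} {Γ : Ctx S.Base} {τ : Ty S.Base}
    (gs : List (Ground S.Base)) (φ : Fml S (τ :: Γ)) (M : Tm S (extend Γ gs) τ) :
    Fml S (extend Γ gs) :=
  φ.subst (Sub.inst gs M)

/-! ### Refinement types and refinement contexts -/

/-- `RTy S Γ σ` is the type of well-formed refinement types with underlying type `σ` over a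
refinement context with underlying context `Γ` (well-formedness depends on nothing else). -/
inductive RTy (S : Signature.{w₁, w₂, w₃}) :
    Ctx S.Base → Ty S.Base → Type (max w₁ w₂ w₃)
  | refine {Γ} (p : Prim S.Base) (φ : Fml S (p.toTy :: Γ)) : RTy S Γ p.toTy
  | prod {Γ σ τ} : RTy S Γ σ → RTy S (σ :: Γ) τ → RTy S Γ (.prod σ τ)
  | zero {Γ} : RTy S Γ .zero
  | sum {Γ σ τ} : RTy S Γ σ → RTy S Γ τ → RTy S Γ (.sum σ τ)
  | fn {Γ σ} : RTy S Γ σ → Fml S (.prop :: σ :: Γ) → RTy S Γ (.fn σ)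

/-- Well-formed refinement contexts, indexed by their underlying contexts. -/
inductive RCtx (S : Signature.{w₁, w₂, w₃}) : Ctx S.Base → Type (max w₁ w₂ w₃)
  | nil : RCtx S []
  | cons {Γ σ} : RCtx S Γ → RTy S Γ σ → RCtx S (σ :: Γ)

/-- `{ v : τ ∣ φ }` for `τ ∈ Base ∪ {Prop}`. -/
def RTy.ground {S : Signature.{w₁, w₂, w₃}} {Γ : Ctx S.Base} (g : Ground S.Base)
    (φ : Fml S (g.toTy :: Γ)) : RTy S Γ g.toTy :=
  .refine (.ground g) φ

/-- `{ v : 1 ∣ φ }`. -/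
def RTy.unit {S : Signature.{w₁, w₂, w₃}} {Γ : Ctx S.Base} (φ : Fml S (.unit :: Γ)) :
    RTy S Γ .unit :=
  .refine .unit φ

/-- `{ (v₁, …, vₙ) : σ₁ × ⋯ × σₙ ∣ φ }`, that is,
`(v₁ : σ₁) × (v₂ : σ₂) × ⋯ × { vₙ : σₙ ∣ φ }`; for `n = 0` it is `{ v : 1 ∣ φ }`. -/
def RTy.tuple {S : Signature.{w₁, w₂, w₃}} :
    ∀ (Γ : Ctx S.Base) (gs : List (Ground S.Base)), Fml S (extend Γ gs) → RTy S Γ (prodTy gs)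
  | _, [], φ => .unit (φ.rename (fun _ x => .succ x))
  | _, [g], φ => .ground g φ
  | Γ, g :: h :: l, φ => .prod (.ground g .top) (RTy.tuple (g.toTy :: Γ) (h :: l) φ)

/-! ### `ωCPO`-enriched bicartesian closed categories -/

/-- An enrichment of `C` over the cartesian monoidal category of `ω`cpos and Scott-continuous
maps: hom-sets are `ω`cpos and composition is Scott-continuous. -/
class OmegaCPOEnriched (C : Type u) [Category.{v} C] where
  homOrder (X Y : C) : OmegaCompletePartialOrder (X ⟶ Y)
  comp_continuous (X Y Z : C) :
    OmegaCompletePartialOrder.ωScottContinuous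
      (fun p : (X ⟶ Y) × (Y ⟶ Z) => p.1 ≫ p.2)

attribute [reducible, instance] OmegaCPOEnriched.homOrder

variable {C : Type u} [Category.{v} C] [CartesianMonoidalCategory C] [MonoidalClosed C]

/-- Currying `Λ f : Γ ⟶ Y ^ X` of `f : Γ ⊗ X ⟶ Y`. -/
def Lam {Γ X Y : C} (f : Γ ⊗ X ⟶ Y) : Γ ⟶ (ihom X).obj Y :=
  MonoidalClosed.curry (lift (snd X Γ) (fst X Γ) ≫ f)

/-- Evaluation `Y ^ X ⊗ X ⟶ Y`. -/
def eval (X Y : C) : (ihom X).obj Y ⊗ X ⟶ Y :=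
  lift (snd ((ihom X).obj Y) X) (fst ((ihom X).obj Y) X) ≫ (ihom.ev X).app Y

variable (C) in
/-- The bicartesian closed structure of `C` is a structure of enriched category: the bijections
`C(Z, X × Y) ≅ C(Z, X) × C(Z, Y)`, `C(X + Y, Z) ≅ C(X, Z) × C(Y, Z)` and
`C(Z × X, Y) ≅ C(Z, Y ^ X)` are isomorphisms of `ω`cpos. In each case one of the two directions
is given by composition, and it remains to require that the other one is monotone. -/
class OmegaBiCCC [HasBinaryCoproducts C] [HasInitial C] extends OmegaCPOEnriched C where
  lift_mono {Z X Y : C} {f f' : Z ⟶ X} {g g' : Z ⟶ Y} : f ≤ f' → g ≤ g' → lift f g ≤ lift f' g'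
  desc_mono {X Y Z : C} {f f' : X ⟶ Z} {g g' : Y ⟶ Z} :
    f ≤ f' → g ≤ g' → coprod.desc f g ≤ coprod.desc f' g'
  Lam_mono {Z X Y : C} {f f' : Z ⊗ X ⟶ Y} : f ≤ f' → Lam f ≤ Lam f'

/-- `a : 1 ⟶ A` is a bottom element of `A`. -/
def IsBottom [OmegaCPOEnriched C] {A : C} (a : 𝟙_ C ⟶ A) : Prop := ∀ f : 𝟙_ C ⟶ A, a ≤ f

variable (C) in
/-- Free algebras of the theory with one constant `⊥` and one inequation `⊥ ≤ x`: `obj X` has a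
bottom element, and every `f : X ⟶ A` into an object with a bottom element extends uniquely along
`η X : X ⟶ obj X` to a bottom-preserving morphism. -/
structure Lifting [OmegaCPOEnriched C] where
  obj : C → C
  η (X : C) : X ⟶ obj X
  bot (X : C) : 𝟙_ C ⟶ obj X
  isBottom_bot (X : C) : IsBottom (bot X)
  ext {X A : C} (a : 𝟙_ C ⟶ A) (ha : IsBottom a) (f : X ⟶ A) : obj X ⟶ A
  η_ext {X A : C} (a : 𝟙_ C ⟶ A) (ha : IsBottom a) (f : X ⟶ A) : η X ≫ ext a ha f = f
  bot_ext {X A : C} (a : 𝟙_ C ⟶ A) (ha : IsBottom a) (f : X ⟶ A) : bot X ≫ ext a ha f = a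
  ext_unique {X A : C} (a : 𝟙_ C ⟶ A) (ha : IsBottom a) (f : X ⟶ A) (g : obj X ⟶ A) :
    η X ≫ g = f → bot X ≫ g = a → g = ext a ha f

namespace Lifting

variable [OmegaCPOEnriched C] (L : Lifting C)

/-- The functorial action of the induced monad. -/
def map {X Y : C} (f : X ⟶ Y) : L.obj X ⟶ L.obj Y :=
  L.ext (L.bot Y) (L.isBottom_bot Y) (f ≫ L.η Y)

/-- The multiplication of the induced monad. -/
def μ (X : C) : L.obj (L.obj X) ⟶ L.obj X :=
  L.ext (L.bot X) (L.isBottom_bot X) (𝟙 (L.obj X))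

/-- The induced monad is strong: it has a natural transformation `X × T Y ⟶ T (X × Y)` compatible
with the monoidal structure, the unit and the multiplication. -/
structure Strength where
  st (X Y : C) : X ⊗ L.obj Y ⟶ L.obj (X ⊗ Y)
  naturality {X X' Y Y' : C} (f : X ⟶ X') (g : Y ⟶ Y') :
    (f ⊗ₘ L.map g) ≫ st X' Y' = st X Y ≫ L.map (f ⊗ₘ g)
  leftUnitor (Y : C) : st (𝟙_ C) Y ≫ L.map (λ_ Y).hom = (λ_ (L.obj Y)).hom
  associator (X Y Z : C) :
    st (X ⊗ Y) Z ≫ L.map (α_ X Y Z).hom =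
      (α_ X Y (L.obj Z)).hom ≫ X ◁ st Y Z ≫ st X (Y ⊗ Z)
  unit (X Y : C) : X ◁ L.η Y ≫ st X Y = L.η (X ⊗ Y)
  mul (X Y : C) : X ◁ L.μ Y ≫ st X Y = st X (L.obj Y) ≫ L.map (st X Y) ≫ L.μ (X ⊗ Y)

end Lifting

variable (C) in
/-- `C` admits a lifting strong monad. -/
class AdmitsLifting [OmegaCPOEnriched C] : Prop where
  exists_strength : ∃ L : Lifting C, Nonempty L.Strength

/-! ### Parameterised fixed points -/

section FixedPoint

variable [HasBinaryCoproducts C] [HasInitial C] [OmegaBiCCC C]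

theorem comp_mono {X Y Z : C} {f f' : X ⟶ Y} {g g' : Y ⟶ Z} (hf : f ≤ f') (hg : g ≤ g') :
    f ≫ g ≤ f' ≫ g' :=
  (OmegaCPOEnriched.comp_continuous X Y Z).monotone (Prod.mk_le_mk.2 ⟨hf, hg⟩)

theorem Lifting.bot_map (L : Lifting C) {X Y : C} (f : X ⟶ Y) : L.bot X ≫ L.map f = L.bot Y :=
  L.bot_ext _ _ _

theorem Lifting.map_comp (L : Lifting C) {X Y Z : C} (f : X ⟶ Y) (g : Y ⟶ Z) :
    L.map f ≫ L.map g = L.map (f ≫ g) := by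
  apply L.ext_unique
  · simp [Lifting.map, L.η_ext, ← Category.assoc]
    simp [L.η_ext]
  · rw [← Category.assoc, L.bot_map, L.bot_map]

theorem Lifting.map_id (L : Lifting C) (X : C) : L.map (𝟙 X) = 𝟙 _ := by
  symm
  apply L.ext_unique <;> simp

theorem Lifting.Strength.st_snd {L : Lifting C} (s : L.Strength) (X Y : C) :
    s.st X Y ≫ L.map (snd X Y) = snd X (L.obj Y) := by
  have h1 : snd X Y = (toUnit X ⊗ₘ 𝟙 Y) ≫ (λ_ Y).hom := by simp [leftUnitor_hom]
  rw [h1, ← L.map_comp, ← Category.assoc, ← s.naturality, Category.assoc, s.leftUnitor, L.map_id]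
  simp [leftUnitor_hom]

/-- The strength preserves bottom elements. -/
theorem Lifting.Strength.st_bot {L : Lifting C} (s : L.Strength) (X Y : C) :
    lift (𝟙 X) (toUnit X ≫ L.bot Y) ≫ s.st X Y = toUnit X ≫ L.bot (X ⊗ Y) := by
  have key : lift (𝟙 X) (toUnit X ≫ L.bot (⊥_ C)) ≫ s.st X (⊥_ C) =
      toUnit X ≫ L.bot (X ⊗ ⊥_ C) := by
    have e : L.map (snd X (⊥_ C)) ≫ L.map (inv (snd X (⊥_ C))) = 𝟙 _ := by
      rw [L.map_comp, IsIso.hom_inv_id, L.map_id]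
    calc _ = (lift (𝟙 X) (toUnit X ≫ L.bot (⊥_ C)) ≫ s.st X (⊥_ C)) ≫
          L.map (snd X (⊥_ C)) ≫ L.map (inv (snd X (⊥_ C))) := by rw [e, Category.comp_id]
      _ = (lift (𝟙 X) (toUnit X ≫ L.bot (⊥_ C)) ≫ s.st X (⊥_ C) ≫ L.map (snd X (⊥_ C))) ≫
          L.map (inv (snd X (⊥_ C))) := by simp only [Category.assoc]
      _ = _ := by rw [s.st_snd, lift_snd, Category.assoc, L.bot_map]
  have h : lift (𝟙 X) (toUnit X ≫ L.bot Y) =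
      lift (𝟙 X) (toUnit X ≫ L.bot (⊥_ C)) ≫ (𝟙 X ⊗ₘ L.map (initial.to Y)) := by
    rw [lift_map, Category.assoc, L.bot_map, Category.comp_id]
  rw [h, Category.assoc, s.naturality, ← Category.assoc, key, Category.assoc, L.bot_map]

variable [AdmitsLifting C]

/-- A bottom element of `A` gives a least element of every hom-set `C(X, A)`. -/
theorem IsBottom.toUnit_comp_le {A : C} {a : 𝟙_ C ⟶ A} (ha : IsBottom a) {X : C} (g : X ⟶ A) :
    toUnit X ≫ a ≤ g := by
  obtain ⟨L, ⟨s⟩⟩ := AdmitsLifting.exists_strength (C := C)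
  let r := L.ext a ha (fst X (𝟙_ C) ≫ g)
  have h1 : lift (𝟙 X) (toUnit X ≫ L.bot (𝟙_ C)) ≫ s.st X (𝟙_ C) ≫ r = toUnit X ≫ a := by
    rw [← Category.assoc, s.st_bot, Category.assoc, L.bot_ext]
  have h2 : lift (𝟙 X) (toUnit X ≫ L.η (𝟙_ C)) ≫ s.st X (𝟙_ C) ≫ r = g := by
    have : lift (𝟙 X) (toUnit X ≫ L.η (𝟙_ C)) =
        lift (𝟙 X) (toUnit X) ≫ X ◁ L.η (𝟙_ C) := by simp
    rw [this, Category.assoc, ← Category.assoc (X ◁ _), s.unit, L.η_ext, lift_fst_assoc,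
      Category.id_comp]
  rw [← h1, ← h2]
  exact comp_mono (OmegaBiCCC.lift_mono le_rfl (comp_mono le_rfl (L.isBottom_bot _ _))) le_rfl

/-- The bottom element of an exponential of an object with a bottom element. -/
def expBot (X : C) {A : C} (a : 𝟙_ C ⟶ A) : 𝟙_ C ⟶ (ihom X).obj A :=
  Lam (toUnit (𝟙_ C ⊗ X) ≫ a)

theorem isBottom_expBot (X : C) {A : C} {a : 𝟙_ C ⟶ A} (ha : IsBottom a) :
    IsBottom (expBot X a) := by
  intro f
  have : f = Lam ((f ▷ X) ≫ eval X A) := by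
    rw [Lam, eval, eq_comm, MonoidalClosed.curry_eq_iff, MonoidalClosed.uncurry_eq]
    simp only [← Category.assoc]
    congr 1
    ext <;> simp
  rw [this]
  exact OmegaBiCCC.Lam_mono (ha.toUnit_comp_le _)

/-- The iterates `⊥, f(-, ⊥), f(-, f(-, ⊥)), …` of `f : X × A ⟶ A`. -/
def iterates {X A : C} (a : 𝟙_ C ⟶ A) (f : X ⊗ A ⟶ A) : ℕ → (X ⟶ A)
  | 0 => toUnit X ≫ a
  | n + 1 => lift (𝟙 X) (iterates a f n) ≫ f

theorem iterates_monotone {X A : C} {a : 𝟙_ C ⟶ A} (ha : IsBottom a) (f : X ⊗ A ⟶ A) :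
    Monotone (iterates a f) := by
  refine monotone_nat_of_le_succ fun n => ?_
  induction n with
  | zero => exact ha.toUnit_comp_le _
  | succ n ih => exact comp_mono (OmegaBiCCC.lift_mono le_rfl ih) le_rfl

/-- The parameterised fixed point `f† : X ⟶ A` of `f : X × A ⟶ A`, for `A` with a bottom element. -/
def dagger {X A : C} {a : 𝟙_ C ⟶ A} (ha : IsBottom a) (f : X ⊗ A ⟶ A) : X ⟶ A :=
  OmegaCompletePartialOrder.ωSup
    (⟨iterates a f, iterates_monotone ha f⟩ : OmegaCompletePartialOrder.Chain (X ⟶ A))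

end FixedPoint

/-! ### Models and interpretation -/

section Semantics

variable [HasBinaryCoproducts C] [HasInitial C] [OmegaBiCCC C] [AdmitsLifting C]

/-- Interpretation of types. -/
noncomputable def Ty.interp {B : Type w₁} (A : B → C) (Ω : C) : Ty B → C
  | .prop => Ω
  | .base b => A b
  | .unit => 𝟙_ C
  | .prod σ τ => σ.interp A Ω ⊗ τ.interp A Ω
  | .zero => ⊥_ C
  | .sum σ τ => σ.interp A Ω ⨿ τ.interp A Ω
  | .fn σ => (ihom (σ.interp A Ω)).obj Ω

variable (C) in
/-- A `λ_HFL`-model over `C`: objects interpreting the base types and `Prop`, a bottom element of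
the latter, and morphisms interpreting the basic operators. -/
structure Model (S : Signature.{w₁, w₂, w₃}) where
  base : S.Base → C
  Ω : C
  bot : 𝟙_ C ⟶ Ω
  isBottom_bot : IsBottom bot
  op {σ τ : Ty S.Base} : S.Op σ τ → (σ.interp base Ω ⟶ τ.interp base Ω)

variable {S : Signature.{w₁, w₂, w₃}}

namespace Model

variable (𝒜 : Model C S)

noncomputable def ty (σ : Ty S.Base) : C := σ.interp 𝒜.base 𝒜.Ω

noncomputable def ctx : Ctx S.Base → C
  | [] => 𝟙_ C
  | σ :: Γ => ctx Γ ⊗ 𝒜.ty σ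

noncomputable def var : ∀ {Γ : Ctx S.Base} {τ : Ty S.Base}, Var Γ τ → (𝒜.ctx Γ ⟶ 𝒜.ty τ)
  | _, _, .zero => snd _ _
  | _, _, .succ x => fst _ _ ≫ var x

/-- Interpretation of well-typed terms. -/
noncomputable def tm : ∀ {Γ : Ctx S.Base} {τ : Ty S.Base}, Tm S Γ τ → (𝒜.ctx Γ ⟶ 𝒜.ty τ)
  | _, _, .var x => 𝒜.var x
  | _, _, .op o M => tm M ≫ 𝒜.op o
  | _, _, .unit => toUnit _
  | _, _, .pair M N => lift (tm M) (tm N)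
  | _, _, .fst (σ := σ) (τ := τ) M => tm M ≫ fst (𝒜.ty σ) (𝒜.ty τ)
  | _, _, .snd (σ := σ) (τ := τ) M => tm M ≫ snd (𝒜.ty σ) (𝒜.ty τ)
  | _, _, .absurd M => tm M ≫ initial.to _
  | _, _, .inl (σ := σ) (τ := τ) M => tm M ≫ (coprod.inl : 𝒜.ty σ ⟶ 𝒜.ty σ ⨿ 𝒜.ty τ)
  | _, _, .inr (σ := σ) (τ := τ) M => tm M ≫ (coprod.inr : 𝒜.ty τ ⟶ 𝒜.ty σ ⨿ 𝒜.ty τ)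
  | Γ, _, .case (σ₁ := σ₁) (σ₂ := σ₂) M N₁ N₂ =>
      lift (𝟙 _) (tm M) ≫ (leftDistrib (𝒜.ctx Γ) (𝒜.ty σ₁) (𝒜.ty σ₂)).inv ≫
        coprod.desc (tm N₁) (tm N₂)
  | _, _, .lam M => Lam (tm M)
  | _, _, .app (σ := σ) M N => lift (tm M) (tm N) ≫ eval (𝒜.ty σ) 𝒜.Ω
  | _, _, .fix (σ := σ) M => dagger (isBottom_expBot (𝒜.ty σ) 𝒜.isBottom_bot) (tm M)

end Model

/-- The interpretation of the atomic predicates `ap : σ` of the signature, as subsets of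
`C(1, ⟦σ⟧)`. -/
def PredInterp (𝒜 : Model C S) :=
  ∀ gs : List (Ground S.Base), S.Pred gs → Set (𝟙_ C ⟶ 𝒜.ty (prodTy gs))

variable {𝒜 : Model C S} (ℐ : PredInterp 𝒜)

namespace PredInterp

/-- Interpretation of all atomic predicates. -/
def atom : ∀ {gs : List (Ground S.Base)}, Atom S gs → Set (𝟙_ C ⟶ 𝒜.ty (prodTy gs))
  | _, .le => {x | x ≫ fst 𝒜.Ω 𝒜.Ω ≤ x ≫ snd 𝒜.Ω 𝒜.Ω}
  | _, .eq g => {x | x ≫ fst (𝒜.ty g.toTy) (𝒜.ty g.toTy) = x ≫ snd (𝒜.ty g.toTy) (𝒜.ty g.toTy)}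
  | gs, .pred p => ℐ gs p

/-- Interpretation of formulas `Γ ⊢ φ` as subsets of `C(1, ⟦Γ⟧)`. -/
def fml {Γ : Ctx S.Base} : Fml S Γ → Set (𝟙_ C ⟶ 𝒜.ctx Γ)
  | .atom a M => {γ | γ ≫ 𝒜.tm M ∈ ℐ.atom a}
  | .top => Set.univ
  | .bot => ∅
  | .imp φ ψ => {γ | γ ∈ fml φ → γ ∈ fml ψ}
  | .and φ ψ => fml φ ∩ fml ψ
  | .or φ ψ => fml φ ∪ fml ψ

/-- Interpretation of refinement types `Γ ⊢ σ`: given the subset `P ⊆ C(1, ⟦Γ⟧)` interpreting the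
refinement context, the subset of `C(1, ⟦Γ⟧ × ⟦σ⟧)` interpreting the refinement type. -/
def rty : ∀ {Γ : Ctx S.Base} {σ : Ty S.Base}, Set (𝟙_ C ⟶ 𝒜.ctx Γ) → RTy S Γ σ →
    Set (𝟙_ C ⟶ 𝒜.ctx Γ ⊗ 𝒜.ty σ)
  | _, _, P, .refine _ φ => {x | x ≫ fst _ _ ∈ P ∧ x ∈ ℐ.fml φ}
  | Γ, _, P, .prod (σ := σ) (τ := τ) s t =>
      {x | lift (lift (x ≫ fst (𝒜.ctx Γ) (𝒜.ty σ ⊗ 𝒜.ty τ))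
              (x ≫ snd (𝒜.ctx Γ) (𝒜.ty σ ⊗ 𝒜.ty τ) ≫ fst (𝒜.ty σ) (𝒜.ty τ)))
            (x ≫ snd (𝒜.ctx Γ) (𝒜.ty σ ⊗ 𝒜.ty τ) ≫ snd (𝒜.ty σ) (𝒜.ty τ)) ∈
          rty (Γ := σ :: Γ) (rty P s) t}
  | _, _, _, .zero => ∅
  | Γ, _, P, .sum (σ := σ) (τ := τ) s t =>
      {x | ∃ y ∈ rty P s, x = y ≫ 𝒜.ctx Γ ◁ (coprod.inl : 𝒜.ty σ ⟶ 𝒜.ty σ ⨿ 𝒜.ty τ)} ∪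
      {x | ∃ y ∈ rty P t, x = y ≫ 𝒜.ctx Γ ◁ (coprod.inr : 𝒜.ty τ ⟶ 𝒜.ty σ ⨿ 𝒜.ty τ)}
  | Γ, _, P, .fn (σ := σ) s φ =>
      {x | x ≫ fst (𝒜.ctx Γ) (𝒜.ty (.fn σ)) ∈ P ∧
        ∀ a : 𝟙_ C ⟶ 𝒜.ty σ, lift (x ≫ fst (𝒜.ctx Γ) (𝒜.ty (.fn σ))) a ∈ rty P s →
          lift (lift (x ≫ fst (𝒜.ctx Γ) (𝒜.ty (.fn σ))) a)
            (lift (x ≫ snd (𝒜.ctx Γ) (𝒜.ty (.fn σ))) a ≫ eval (𝒜.ty σ) 𝒜.Ω) ∈ ℐ.fml φ}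

/-- Interpretation of refinement contexts. -/
def rctx : ∀ {Γ : Ctx S.Base}, RCtx S Γ → Set (𝟙_ C ⟶ 𝒜.ctx Γ)
  | _, .nil => Set.univ
  | _, .cons G s => ℐ.rty (rctx G) s

end PredInterp

/-! ### Typing rules and their soundness -/

/-- Families of typing judgements `Γ ⊢ M : σ` of the refinement type system. By construction, `Γ`
and `σ` are well-formed and `M` is a simply typed term of the underlying type of `σ`. -/
abbrev Judgement (S : Signature.{w₁, w₂, w₃}) :=
  ∀ ⦃Γ : Ctx S.Base⦄ ⦃σ : Ty S.Base⦄, RCtx S Γ → Tm S Γ σ → RTy S Γ σ → Prop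

/-- The judgement `Γ ⊢ M : σ` is semantically valid: `⟨id, ⟦M⟧⟩` maps the interpretation of `Γ`
into that of `Γ, v : σ`. A typing rule is sound if its conclusion is valid whenever its premises
are. -/
def Valid : Judgement S := fun _ _ G M s =>
  ∀ γ ∈ ℐ.rctx G, lift γ (γ ≫ 𝒜.tm M) ∈ ℐ.rctx (.cons G s)

/-- `J` is closed under the rule for the unit term, with conclusion `Γ ⊢ () : { v : 1 ∣ ⊤ }`. -/
def RUnit (J : Judgement S) : Prop :=
  ∀ ⦃Γ : Ctx S.Base⦄ (G : RCtx S Γ), J G .unit (.unit .top)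

/-- `J` is closed under the general rule R-BasicOp for basic operators. -/
def RBasicOp (J : Judgement S) : Prop :=
  ∀ ⦃Γ : Ctx S.Base⦄ ⦃σ τ : Ty S.Base⦄ (G : RCtx S Γ) (s : RTy S Γ σ) (t : RTy S Γ τ)
    (o : S.Op σ τ) (M : Tm S Γ σ),
    J G M s →
    (∀ γ ∈ ℐ.rctx (.cons G s), γ ≫ 𝒜.ctx Γ ◁ 𝒜.op o ∈ ℐ.rctx (.cons G t)) →
    J G (.op o M) t

/-- `J` is closed under R-BasicConst, with conclusion `Γ ⊢ op : { v : τ ∣ v =_τ op }` for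
`op : 1 ⇸ τ` and `τ ∈ Base ∪ {Prop}`. -/
def RBasicConst (J : Judgement S) : Prop :=
  ∀ ⦃Γ : Ctx S.Base⦄ (G : RCtx S Γ) (τ : Ground S.Base) (o : S.Op .unit τ.toTy),
    J G (.op o .unit)
      (.ground τ (.atom (.eq τ) (.pair (.var .zero) (.op o .unit))))

/-- `J` is closed under R-BasicSimp: for `op : σ₁ × ⋯ × σₙ ⇸ τ` with
`σ₁, …, σₙ, τ ∈ Base ∪ {Prop}`, if
`Γ ⊢ M : { (v₁, …, vₙ) : σ₁ × ⋯ × σₙ ∣ φ[op (v₁, …, vₙ) / v] }` then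
`Γ ⊢ op M : { v : τ ∣ φ }`. -/
def RBasicSimp (J : Judgement S) : Prop :=
  ∀ ⦃Γ : Ctx S.Base⦄ (G : RCtx S Γ) (σs : List (Ground S.Base)) (τ : Ground S.Base)
    (o : S.Op (prodTy σs) τ.toTy) (φ : Fml S (τ.toTy :: Γ)) (M : Tm S Γ (prodTy σs)),
    J G M (.tuple Γ σs (φ.inst σs (.op o (tupleVars Γ σs)))) →
    J G (.op o M) (.ground τ φ)

/-- `J` is closed under R-BasicBool: for `op : σ₁ × ⋯ × σₙ ⇸ 1 + 1` with
`σ₁, …, σₙ ∈ Base ∪ {Prop}`, if the formulas `v₁ : σ₁, …, vₙ : σₙ ⊢ ψt, ψf` imply that `op`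
returns `ι₁ ()` and `ι₂ ()`, respectively, and
`Γ ⊢ M : { (v₁, …, vₙ) : σ₁ × ⋯ × σₙ ∣ ψt ∧ φt[() / v] ∨ ψf ∧ φf[() / v] }`, then
`Γ ⊢ op M : { v : 1 ∣ φt } + { v : 1 ∣ φf }`. -/
def RBasicBool (J : Judgement S) : Prop :=
  ∀ ⦃Γ : Ctx S.Base⦄ (G : RCtx S Γ) (σs : List (Ground S.Base))
    (o : S.Op (prodTy σs) (.sum .unit .unit)) (ψt ψf : Fml S (extend [] σs))
    (φt φf : Fml S (.unit :: Γ)) (M : Tm S Γ (prodTy σs)),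
    (∀ γ ∈ ℐ.fml ψt, γ ≫ 𝒜.tm (tupleVars [] σs) ≫ 𝒜.op o =
      (coprod.inl : 𝟙_ C ⟶ 𝟙_ C ⨿ 𝟙_ C)) →
    (∀ γ ∈ ℐ.fml ψf, γ ≫ 𝒜.tm (tupleVars [] σs) ≫ 𝒜.op o =
      (coprod.inr : 𝟙_ C ⟶ 𝟙_ C ⨿ 𝟙_ C)) →
    J G M (.tuple Γ σs
      (.or (.and (ψt.rename (fromClosed Γ σs)) (φt.inst σs .unit))
        (.and (ψf.rename (fromClosed Γ σs)) (φf.inst σs .unit)))) →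
    J G (.op o M) (.sum (.unit φt) (.unit φf))

end Semantics

end LambdaHFL

/-!
All three rules are instances of R-BasicOp, and R-BasicOp itself is valid because
`⟨γ, ⟦op M⟧ ∘ γ⟩ = (id × a(op)) ∘ ⟨γ, ⟦M⟧ ∘ γ⟩`. Soundness of the three rules is therefore the special
case of the closure statement in which the family consists of the valid judgements.

For the closure statement, the semantic side condition of R-BasicOp has to be checked in each case,
and this rests on two facts.

* Substitution is composition: if `m : ⟦Δ⟧ ⟶ ⟦Γ⟧` is the tuple of the interpretations of the terms of
  a substitution `s`, then `⟦M[s]⟧ = ⟦M⟧ ∘ m` (`Model.tm_subst`), hence `γ ∈ ⟦φ[s]⟧` iff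
  `m ∘ γ ∈ ⟦φ⟧` (`PredInterp.mem_fml_subst`). Each binding constructor of terms needs naturality in
  the context; for fixed points this is the Scott-continuity of composition (`comp_dagger`).
* The refinement type of tuples: `⟨γ, a⟩` lies in `{ (v₁, …, vₙ) ∣ φ }` over a refinement context iff
  `γ` lies in the context and the environment `γ, a₁, …, aₙ` formed with the components of `a` (the
  morphism `Model.unpack`) satisfies `φ` (`PredInterp.mem_rty_tuple`). In this environment the term
  `(v₁, …, vₙ)` evaluates to `a` (`Model.unpack_tupleVars`).

Hence the premise of R-BasicSimp says that `φ` holds of `a(op)` applied to `a`, and the premise of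
R-BasicBool says that one of the disjuncts `ψ ∧ φ[()/v]` holds, where `ψ` determines the value of
`a(op)` on `a` and `φ[()/v]` puts this value into the corresponding summand.
-/

namespace LambdaHFL

/-! ### Naturality of the semantic operations in the context -/

section Naturality

variable {C : Type u} [Category.{v} C] [CartesianMonoidalCategory C]

theorem comp_iterates {X Y A : C} (m : X ⟶ Y) (a : 𝟙_ C ⟶ A) (f : Y ⊗ A ⟶ A) (n : ℕ) :
    m ≫ iterates a f n = iterates a (m ▷ A ≫ f) n := by
  induction n with
  | zero => simp [iterates]
  | succ n ih => simp [iterates, ← ih, ← Category.assoc, comp_lift]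

variable [MonoidalClosed C]

theorem comp_Lam {X Y Z A : C} (m : X ⟶ Y) (f : Y ⊗ Z ⟶ A) : m ≫ Lam f = Lam (m ▷ Z ≫ f) := by
  rw [Lam, Lam, ← MonoidalClosed.curry_natural_left]
  congr 1
  simp only [← Category.assoc]
  congr 1
  ext <;> simp

/-- Naturality in the context of the interpretation of case analysis. -/
theorem comp_leftDistrib_inv [HasBinaryCoproducts C] {X Y A B Z : C} (m : X ⟶ Y)
    (t : Y ⟶ A ⨿ B) (f : Y ⊗ A ⟶ Z) (g : Y ⊗ B ⟶ Z) :
    m ≫ lift (𝟙 _) t ≫ (leftDistrib Y A B).inv ≫ coprod.desc f g =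
      lift (𝟙 _) (m ≫ t) ≫ (leftDistrib X A B).inv ≫
        coprod.desc (m ▷ A ≫ f) (m ▷ B ≫ g) := by
  have h : m ▷ (A ⨿ B) ≫ (leftDistrib Y A B).inv ≫ coprod.desc f g =
      (leftDistrib X A B).inv ≫ coprod.desc (m ▷ A ≫ f) (m ▷ B ≫ g) := by
    rw [Iso.eq_inv_comp]
    ext
    · rw [coprod_inl_leftDistrib_hom_assoc, whisker_exchange_assoc, coprod.inl_desc,
        ← coprod_inl_leftDistrib_hom_assoc, Iso.hom_inv_id_assoc, coprod.inl_desc]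
    · rw [coprod_inr_leftDistrib_hom_assoc, whisker_exchange_assoc, coprod.inr_desc,
        ← coprod_inr_leftDistrib_hom_assoc, Iso.hom_inv_id_assoc, coprod.inr_desc]
  rw [← h]
  simp only [← Category.assoc]
  congr 2
  ext <;> simp

variable [HasBinaryCoproducts C] [HasInitial C] [OmegaBiCCC C] [AdmitsLifting C]

open OmegaCompletePartialOrder in
/-- Precomposition is Scott-continuous, hence commutes with the supremum of the iterates. -/
theorem comp_dagger {X Y A : C} (m : X ⟶ Y) {a : 𝟙_ C ⟶ A} (ha : IsBottom a) (f : Y ⊗ A ⟶ A) :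
    m ≫ dagger ha f = dagger ha (m ▷ A ≫ f) := by
  let c : Chain (Y ⟶ A) := ⟨iterates a f, iterates_monotone ha f⟩
  -- The chain of pairs `(m, cₙ)`, constant in the first component.
  let k : Chain ((X ⟶ Y) × (Y ⟶ A)) := c.map ((OrderHom.const _ m).prod OrderHom.id)
  have hk : ωSup k = (m, dagger ha f) :=
    Prod.ext (le_antisymm (ωSup_le _ _ fun _ => le_rfl) (le_ωSup (k.map OrderHom.fst) 0)) rfl
  have h := (OmegaCPOEnriched.comp_continuous X Y A).map_ωSup k
  rw [hk] at h
  refine h.trans (congrArg ωSup (DFunLike.ext _ _ fun n => ?_))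
  exact comp_iterates m a f n

end Naturality

/-! ### Substitution is interpreted by composition -/

namespace Model

variable {C : Type u} [Category.{v} C] [CartesianMonoidalCategory C] [MonoidalClosed C]
  [HasBinaryCoproducts C] [HasInitial C] [OmegaBiCCC C]
  {S : Signature.{w₁, w₂, w₃}} (𝒜 : Model C S)

/-- `m` interprets the renaming `ρ`: it sends an environment for `Δ` to the environment for `Γ` whose
value at `x` is that of `ρ x`. -/
def InterpretsRen {Γ Δ : Ctx S.Base} (m : 𝒜.ctx Δ ⟶ 𝒜.ctx Γ) (ρ : Ren Γ Δ) : Prop :=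
  ∀ ⦃τ : Ty S.Base⦄ (x : Var Γ τ), m ≫ 𝒜.var x = 𝒜.var (ρ x)

variable {𝒜}

theorem InterpretsRen.lift {Γ Δ : Ctx S.Base} {m : 𝒜.ctx Δ ⟶ 𝒜.ctx Γ} {ρ : Ren Γ Δ}
    (h : 𝒜.InterpretsRen m ρ) (σ : Ty S.Base) :
    𝒜.InterpretsRen (Γ := σ :: Γ) (Δ := σ :: Δ) (m ▷ 𝒜.ty σ) (ρ.lift σ) := by
  intro τ x
  cases x with
  | zero => exact whiskerRight_snd _ _
  | succ x =>
    change m ▷ 𝒜.ty σ ≫ fst (𝒜.ctx Γ) (𝒜.ty σ) ≫ 𝒜.var x = fst (𝒜.ctx Δ) (𝒜.ty σ) ≫ 𝒜.var (ρ x)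
    rw [whiskerRight_fst_assoc, h x]

theorem interpretsRen_succ (Γ : Ctx S.Base) (σ : Ty S.Base) :
    𝒜.InterpretsRen (Γ := Γ) (Δ := σ :: Γ) (fst (𝒜.ctx Γ) (𝒜.ty σ)) (fun _ x => .succ x) :=
  fun _ _ => rfl

variable [AdmitsLifting C]

/-- Weakening under a binder makes the case of renamings a prerequisite of `tm_subst`. -/
theorem tm_rename {Γ : Ctx S.Base} {τ : Ty S.Base} (M : Tm S Γ τ) {Δ : Ctx S.Base}
    {ρ : Ren Γ Δ} {m : 𝒜.ctx Δ ⟶ 𝒜.ctx Γ} (h : 𝒜.InterpretsRen m ρ) :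
    𝒜.tm (M.rename ρ) = m ≫ 𝒜.tm M := by
  induction M generalizing Δ with
  | var x => exact (h x).symm
  | unit => exact toUnit_unique _ _
  | op o M ih | fst M ih | snd M ih | absurd M ih | inl M ih | inr M ih =>
    simp only [Tm.rename, tm, ih h]
    exact Category.assoc _ _ _
  | pair M N ihM ihN =>
    simp only [Tm.rename, tm, ihM h, ihN h]
    exact (comp_lift _ _ _).symm
  | app M N ihM ihN =>
    simp only [Tm.rename, tm, ihM h, ihN h]
    exact (comp_lift_assoc _ _ _ _).symm
  | case M N₁ N₂ ihM ih₁ ih₂ =>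
    simp only [Tm.rename, tm, ihM h, ih₁ (h.lift _), ih₂ (h.lift _)]
    exact (comp_leftDistrib_inv _ _ _ _).symm
  | lam M ih =>
    simp only [Tm.rename, tm, ih (h.lift _)]
    exact (comp_Lam _ _).symm
  | fix M ih =>
    simp only [Tm.rename, tm, ih (h.lift _)]
    exact (comp_dagger _ _ _).symm

variable (𝒜) in
/-- `m` interprets the substitution `s`: it sends an environment for `Δ` to the environment for `Γ`
whose value at `x` is that of the term `s x`. -/
def InterpretsSub {Γ Δ : Ctx S.Base} (m : 𝒜.ctx Δ ⟶ 𝒜.ctx Γ) (s : Sub S Γ Δ) : Prop :=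
  ∀ ⦃τ : Ty S.Base⦄ (x : Var Γ τ), m ≫ 𝒜.var x = 𝒜.tm (s x)

theorem InterpretsRen.toSub {Γ Δ : Ctx S.Base} {m : 𝒜.ctx Δ ⟶ 𝒜.ctx Γ} {ρ : Ren Γ Δ}
    (h : 𝒜.InterpretsRen m ρ) : 𝒜.InterpretsSub m (fun _ x => .var (ρ x)) :=
  h

theorem InterpretsSub.lift {Γ Δ : Ctx S.Base} {m : 𝒜.ctx Δ ⟶ 𝒜.ctx Γ} {s : Sub S Γ Δ}
    (h : 𝒜.InterpretsSub m s) (σ : Ty S.Base) :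
    𝒜.InterpretsSub (Γ := σ :: Γ) (Δ := σ :: Δ) (m ▷ 𝒜.ty σ) (s.lift σ) := by
  intro τ x
  cases x with
  | zero => exact whiskerRight_snd _ _
  | succ x =>
    change m ▷ 𝒜.ty σ ≫ fst (𝒜.ctx Γ) (𝒜.ty σ) ≫ 𝒜.var x =
      𝒜.tm ((s x).rename (Δ := σ :: Δ) fun _ z => .succ z)
    rw [whiskerRight_fst_assoc, h x]
    exact (tm_rename _ (interpretsRen_succ Δ σ)).symm

theorem tm_subst {Γ : Ctx S.Base} {τ : Ty S.Base} (M : Tm S Γ τ) {Δ : Ctx S.Base}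
    {s : Sub S Γ Δ} {m : 𝒜.ctx Δ ⟶ 𝒜.ctx Γ} (h : 𝒜.InterpretsSub m s) :
    𝒜.tm (M.subst s) = m ≫ 𝒜.tm M := by
  induction M generalizing Δ with
  | var x => exact (h x).symm
  | unit => exact toUnit_unique _ _
  | op o M ih | fst M ih | snd M ih | absurd M ih | inl M ih | inr M ih =>
    simp only [Tm.subst, tm, ih h]
    exact Category.assoc _ _ _
  | pair M N ihM ihN =>
    simp only [Tm.subst, tm, ihM h, ihN h]
    exact (comp_lift _ _ _).symm
  | app M N ihM ihN =>
    simp only [Tm.subst, tm, ihM h, ihN h]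
    exact (comp_lift_assoc _ _ _ _).symm
  | case M N₁ N₂ ihM ih₁ ih₂ =>
    simp only [Tm.subst, tm, ihM h, ih₁ (h.lift _), ih₂ (h.lift _)]
    exact (comp_leftDistrib_inv _ _ _ _).symm
  | lam M ih =>
    simp only [Tm.subst, tm, ih (h.lift _)]
    exact (comp_Lam _ _).symm
  | fix M ih =>
    simp only [Tm.subst, tm, ih (h.lift _)]
    exact (comp_dagger _ _ _).symm

end Model

section Formulas

variable {C : Type u} [Category.{v} C] [CartesianMonoidalCategory C] [MonoidalClosed C]
  [HasBinaryCoproducts C] [HasInitial C] [OmegaBiCCC C] [AdmitsLifting C]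
  {S : Signature.{w₁, w₂, w₃}} {𝒜 : Model C S} (ℐ : PredInterp 𝒜)

theorem PredInterp.mem_fml_subst {Γ Δ : Ctx S.Base} {s : Sub S Γ Δ} {m : 𝒜.ctx Δ ⟶ 𝒜.ctx Γ}
    (h : 𝒜.InterpretsSub m s) (φ : Fml S Γ) (γ : 𝟙_ C ⟶ 𝒜.ctx Δ) :
    γ ∈ ℐ.fml (φ.subst s) ↔ γ ≫ m ∈ ℐ.fml φ := by
  induction φ generalizing Δ with
  | atom a M => simp [Fml.subst, fml, Model.tm_subst M h]
  | top | bot => simp [Fml.subst, fml]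
  | imp φ ψ ih₁ ih₂ | and φ ψ ih₁ ih₂ | or φ ψ ih₁ ih₂ =>
    simp [Fml.subst, fml, ih₁ h γ, ih₂ h γ]

theorem PredInterp.mem_fml_rename {Γ Δ : Ctx S.Base} {ρ : Ren Γ Δ} {m : 𝒜.ctx Δ ⟶ 𝒜.ctx Γ}
    (h : 𝒜.InterpretsRen m ρ) (φ : Fml S Γ) (γ : 𝟙_ C ⟶ 𝒜.ctx Δ) :
    γ ∈ ℐ.fml (φ.rename ρ) ↔ γ ≫ m ∈ ℐ.fml φ :=
  ℐ.mem_fml_subst h.toSub φ γ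

end Formulas

/-! ### Tuples of variables -/

-- These facts are stated for arbitrary objects, because the interpretations of product types and of
-- extended contexts are products only up to unfolding, which rewriting does not see.
section Cartesian

variable {C : Type u} [Category.{v} C] [CartesianMonoidalCategory C]

/-- The induction step of `Model.unpack_proj`: moving the first component `A` of a tuple into the
context does not affect the projection to `X`. -/
theorem associator_inv_comp_fst {X A B Y : C} {a : (X ⊗ A) ⊗ B ⟶ Y} {p : Y ⟶ X ⊗ A}
    (hp : a ≫ p = fst _ _) : ((α_ X A B).inv ≫ a) ≫ p ≫ fst X A = fst X (A ⊗ B) := by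
  rw [Category.assoc, reassoc_of% hp, associator_inv_fst_fst]

/-- The induction step of `Model.unpack_tupleVars`: the tuple of a first variable `q` and the
remaining tuple `t`. -/
theorem associator_inv_comp_lift {X A B Y : C} {a : (X ⊗ A) ⊗ B ⟶ Y} {p : Y ⟶ X ⊗ A}
    {q : Y ⟶ A} {t : Y ⟶ B} (hp : a ≫ p = fst _ _) (hq : p ≫ snd X A = q)
    (ht : a ≫ t = snd _ _) : ((α_ X A B).inv ≫ a) ≫ lift q t = snd X (A ⊗ B) := by
  subst hq
  rw [Category.assoc, comp_lift, ht, reassoc_of% hp]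
  ext <;> simp

theorem comp_associator_inv {Z X A B : C} (x : Z ⟶ X ⊗ A ⊗ B) :
    x ≫ (α_ X A B).inv =
      lift (lift (x ≫ fst _ _) (x ≫ snd _ _ ≫ fst _ _)) (x ≫ snd _ _ ≫ snd _ _) := by
  ext <;> simp

/-- If `m ≫ t` recovers the second component from `a`, then applying `f` to the second component
of `x` amounts to applying it to the value of `t`. -/
theorem comp_whiskerLeft_of_snd {T X A B Y Z : C} (x : T ⟶ X ⊗ A) {a : X ⊗ A ⟶ Y} {m : Y ⟶ Z}
    {t : Z ⟶ A} (h : a ≫ m ≫ t = snd _ _) (f : A ⟶ B) :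
    x ≫ X ◁ f = lift (x ≫ fst _ _) (((x ≫ a) ≫ m) ≫ t ≫ f) := by
  have h' : ((x ≫ a) ≫ m) ≫ t ≫ f = x ≫ (a ≫ m ≫ t) ≫ f := by simp only [Category.assoc]
  rw [h', h]
  ext <;> simp

theorem lift_unit_comp_whiskerLeft {X B : C} (x : 𝟙_ C ⟶ X) (s : 𝟙_ C ⟶ 𝟙_ C) (i : 𝟙_ C ⟶ B) :
    lift x s ≫ X ◁ i = lift x i := by
  rw [toUnit_unique s (𝟙 _), lift_whiskerLeft, Category.id_comp]

/-- Two ways to evaluate a constant `f` agree: at the second component of `x`, or at the unit. -/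
theorem comp_constant_eq {X B : C} (x : 𝟙_ C ⟶ X ⊗ 𝟙_ C) (f : 𝟙_ C ⟶ B) :
    ((x ≫ X ◁ f) ≫ lift (snd X B) (toUnit _ ≫ f)) ≫ fst B B =
      ((x ≫ X ◁ f) ≫ lift (snd X B) (toUnit _ ≫ f)) ≫ snd B B := by
  have h : x ≫ snd X (𝟙_ C) = x ≫ X ◁ f ≫ toUnit (X ⊗ B) := toUnit_unique _ _
  simp only [Category.assoc, lift_fst, lift_snd, whiskerLeft_snd]
  rw [reassoc_of% h]

end Cartesian

theorem Ren.liftAll_weaken {B : Type w₁} {Γ Δ : Ctx B} (ρ : Ren Γ Δ) (gs : List (Ground B))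
    {τ : Ty B} (x : Var Γ τ) : ρ.liftAll gs (weaken gs x) = weaken gs (ρ x) := by
  induction gs generalizing Γ Δ with
  | nil => rfl
  | cons g l ih => exact ih (ρ.lift g.toTy) (.succ x)

variable {C : Type u} [Category.{v} C] [CartesianMonoidalCategory C] [MonoidalClosed C]
  [HasBinaryCoproducts C] [HasInitial C] [OmegaBiCCC C] {S : Signature.{w₁, w₂, w₃}}

namespace Model

variable (𝒜 : Model C S)

/-- The projection `⟦Γ, v₁ : σ₁, …, vₙ : σₙ⟧ ⟶ ⟦Γ⟧`. -/
noncomputable def proj : ∀ (Γ : Ctx S.Base) (gs : List (Ground S.Base)),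
    𝒜.ctx (extend Γ gs) ⟶ 𝒜.ctx Γ
  | _, [] => 𝟙 _
  | Γ, g :: l => proj (g.toTy :: Γ) l ≫ fst (𝒜.ctx Γ) (𝒜.ty g.toTy)

/-- The morphism `⟦Γ⟧ × ⟦σ₁ × ⋯ × σₙ⟧ ⟶ ⟦Γ, v₁ : σ₁, …, vₙ : σₙ⟧` that assigns the components of a
tuple to the variables `v₁, …, vₙ`. -/
noncomputable def unpack : ∀ (Γ : Ctx S.Base) (gs : List (Ground S.Base)),
    𝒜.ctx Γ ⊗ 𝒜.ty (prodTy gs) ⟶ 𝒜.ctx (extend Γ gs)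
  | _, [] => fst _ _
  | _, [_] => 𝟙 _
  | Γ, g :: h :: l =>
      (α_ (𝒜.ctx Γ) (𝒜.ty g.toTy) (𝒜.ty (prodTy (h :: l)))).inv ≫ unpack (g.toTy :: Γ) (h :: l)

theorem interpretsRen_proj (Γ : Ctx S.Base) (gs : List (Ground S.Base)) :
    𝒜.InterpretsRen (𝒜.proj Γ gs) (weaken gs) := by
  intro τ x
  induction gs generalizing Γ with
  | nil => exact Category.id_comp _
  | cons g l ih => exact (Category.assoc _ _ _).trans (ih (g.toTy :: Γ) (.succ x))

theorem unpack_proj : ∀ (Γ : Ctx S.Base) (gs : List (Ground S.Base)),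
    𝒜.unpack Γ gs ≫ 𝒜.proj Γ gs = fst (𝒜.ctx Γ) (𝒜.ty (prodTy gs))
  | _, [] => Category.comp_id _
  | _, [_] => (Category.id_comp _).trans (Category.id_comp _)
  | Γ, g :: h :: l => associator_inv_comp_fst (unpack_proj (g.toTy :: Γ) (h :: l))

variable [AdmitsLifting C]

theorem unpack_tupleVars : ∀ (Γ : Ctx S.Base) (gs : List (Ground S.Base)),
    𝒜.unpack Γ gs ≫ 𝒜.tm (tupleVars Γ gs) = snd (𝒜.ctx Γ) (𝒜.ty (prodTy gs))
  | _, [] => toUnit_unique _ _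
  | _, [_] => Category.id_comp _
  | Γ, g :: h :: l =>
    associator_inv_comp_lift (𝒜.unpack_proj (g.toTy :: Γ) (h :: l))
      (𝒜.interpretsRen_proj (g.toTy :: Γ) (h :: l) .zero)
      (unpack_tupleVars (g.toTy :: Γ) (h :: l))

variable {𝒜} in
/-- A morphism interpreting a renaming extends to the additional variables `v₁, …, vₙ`, and
preserves the tuple that they form. -/
theorem InterpretsRen.exists_liftAll {Γ Δ : Ctx S.Base} {m : 𝒜.ctx Δ ⟶ 𝒜.ctx Γ} {ρ : Ren Γ Δ}
    (h : 𝒜.InterpretsRen m ρ) : ∀ gs : List (Ground S.Base),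
    ∃ m' : 𝒜.ctx (extend Δ gs) ⟶ 𝒜.ctx (extend Γ gs), 𝒜.InterpretsRen m' (ρ.liftAll gs) ∧
      m' ≫ 𝒜.tm (tupleVars Γ gs) = 𝒜.tm (tupleVars Δ gs)
  | [] => ⟨m, h, toUnit_unique _ _⟩
  | [g] => ⟨m ▷ 𝒜.ty g.toTy, h.lift g.toTy, whiskerRight_snd _ _⟩
  | g :: g' :: l => by
    obtain ⟨m', hm, ht⟩ := (h.lift g.toTy).exists_liftAll (g' :: l)
    exact ⟨m', hm, (comp_lift _ _ _).trans (congrArg₂ CartesianMonoidalCategory.lift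
      ((hm _).trans (congrArg 𝒜.var (Ren.liftAll_weaken (ρ.lift g.toTy) (g' :: l) .zero))) ht)⟩

theorem interpretsSub_inst {Γ : Ctx S.Base} {τ : Ty S.Base} (gs : List (Ground S.Base))
    (M : Tm S (extend Γ gs) τ) :
    𝒜.InterpretsSub (Γ := τ :: Γ) (lift (𝒜.proj Γ gs) (𝒜.tm M)) (Sub.inst gs M) := by
  intro σ x
  cases x with
  | zero => exact lift_snd _ _
  | succ x => exact (lift_fst_assoc _ _ _).trans (𝒜.interpretsRen_proj Γ gs x)

end Model

variable [AdmitsLifting C] {𝒜 : Model C S} (ℐ : PredInterp 𝒜)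

namespace PredInterp

/-- An element of `{ (v₁, …, vₙ) : σ₁ × ⋯ × σₙ ∣ φ }` is a tuple whose components satisfy `φ`. -/
theorem mem_rty_tuple : ∀ (Γ : Ctx S.Base) (gs : List (Ground S.Base)) (φ : Fml S (extend Γ gs))
    (P : Set (𝟙_ C ⟶ 𝒜.ctx Γ)) (x : 𝟙_ C ⟶ 𝒜.ctx Γ ⊗ 𝒜.ty (prodTy gs)),
    x ∈ ℐ.rty P (.tuple Γ gs φ) ↔ x ≫ fst _ _ ∈ P ∧ x ≫ 𝒜.unpack Γ gs ∈ ℐ.fml φ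
  | Γ, [], φ, _, x => and_congr_right fun _ =>
    ℐ.mem_fml_rename (Model.interpretsRen_succ Γ .unit) φ x
  | _, [_], φ, _, x => and_congr_right fun _ =>
    iff_of_eq (congrArg (· ∈ ℐ.fml φ) (Category.comp_id x).symm)
  | Γ, g :: h :: l, φ, P, x => by
    have ih := mem_rty_tuple (g.toTy :: Γ) (h :: l) φ (ℐ.rty P (.ground g .top))
      (x ≫ (α_ (𝒜.ctx Γ) (𝒜.ty g.toTy) (𝒜.ty (prodTy (h :: l)))).inv)
    refine (iff_of_eq (congrArg
      (· ∈ ℐ.rty (Γ := g.toTy :: Γ) (ℐ.rty P (.ground g .top)) (.tuple _ (h :: l) φ))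
      (comp_associator_inv x).symm)).trans (ih.trans (and_congr ?_ ?_))
    · refine (and_iff_left (Set.mem_univ _)).trans (iff_of_eq (congrArg (· ∈ P) ?_))
      refine (Category.assoc _ _ _).trans ((Category.assoc _ _ _).trans ?_)
      exact congrArg (x ≫ ·) (associator_inv_fst_fst _ _ _)
    · exact iff_of_eq (congrArg (· ∈ ℐ.fml φ) (Category.assoc _ _ _))

/-- The components of a tuple satisfy `φ[M / v]` iff `φ` holds of the value of `M` at them. -/
theorem mem_fml_inst {Γ : Ctx S.Base} {τ : Ty S.Base} (gs : List (Ground S.Base))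
    (φ : Fml S (τ :: Γ)) (M : Tm S (extend Γ gs) τ) (x : 𝟙_ C ⟶ 𝒜.ctx Γ ⊗ 𝒜.ty (prodTy gs)) :
    x ≫ 𝒜.unpack Γ gs ∈ ℐ.fml (φ.inst gs M) ↔
      lift (x ≫ fst _ _) ((x ≫ 𝒜.unpack Γ gs) ≫ 𝒜.tm M) ∈ ℐ.fml φ := by
  rw [← 𝒜.unpack_proj, ← Category.assoc, ← comp_lift]
  exact ℐ.mem_fml_subst (𝒜.interpretsSub_inst gs M) φ _

end PredInterp

/-! ### The typing rules -/

theorem valid_rUnit : RUnit (Valid ℐ) :=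
  fun _ _ _ hγ => ⟨Set.mem_of_eq_of_mem (lift_fst _ _) hγ, Set.mem_univ _⟩

theorem valid_rBasicOp : RBasicOp ℐ (Valid ℐ) := fun _ _ _ _ _ _ o M hM ho γ hγ =>
  Set.mem_of_eq_of_mem ((congrArg (lift γ) (Category.assoc γ (𝒜.tm M) (𝒜.op o)).symm).trans
    (lift_whiskerLeft _ _ _).symm) (ho _ (hM γ hγ))

variable {ℐ} {J : Judgement S}

theorem RBasicOp.rBasicConst (hJ : RBasicOp ℐ J) (hU : RUnit J) : RBasicConst J :=
  fun _ G _ o => hJ G _ _ o .unit (hU G) fun γ hγ =>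
    ⟨Set.mem_of_eq_of_mem ((Category.assoc _ _ _).trans
      (congrArg (γ ≫ ·) (whiskerLeft_fst _ _))) hγ.1, comp_constant_eq γ (𝒜.op o)⟩

theorem RBasicOp.rBasicSimp (hJ : RBasicOp ℐ J) : RBasicSimp J := by
  intro Γ G gs τ o φ M hM
  refine hJ G _ _ o M hM fun γ hγ => ?_
  obtain ⟨hG, hφ⟩ := (ℐ.mem_rty_tuple Γ gs _ _ γ).1 hγ
  have hop := comp_whiskerLeft_of_snd γ (m := 𝟙 _)
    ((congrArg _ (Category.id_comp _)).trans (𝒜.unpack_tupleVars Γ gs)) (𝒜.op o)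
  rw [Category.comp_id] at hop
  exact Set.mem_of_eq_of_mem hop
    ⟨Set.mem_of_eq_of_mem (lift_fst _ _) hG, (ℐ.mem_fml_inst gs φ _ γ).1 hφ⟩

theorem RBasicOp.rBasicBool (hJ : RBasicOp ℐ J) : RBasicBool ℐ J := by
  intro Γ G gs o ψt ψf φt φf M ht hf hM
  refine hJ G _ _ o M hM fun γ hγ => ?_
  obtain ⟨hG, hφ⟩ := (ℐ.mem_rty_tuple Γ gs _ _ γ).1 hγ
  obtain ⟨m, hm, hmt⟩ := Model.InterpretsRen.exists_liftAll (𝒜 := 𝒜) (Γ := []) (Δ := Γ)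
    (m := toUnit _) (ρ := fun _ x => by cases x) (fun _ x => by cases x) gs
  -- The components of `γ` are turned into a closed tuple, to which the hypotheses on `op` apply.
  have hop := comp_whiskerLeft_of_snd γ
    ((congrArg (𝒜.unpack Γ gs ≫ ·) hmt).trans (𝒜.unpack_tupleVars Γ gs)) (𝒜.op o)
  have hmem (φ : Fml S (.unit :: Γ)) (h : γ ≫ 𝒜.unpack Γ gs ∈ ℐ.fml (φ.inst gs .unit)) :
      lift (γ ≫ fst _ _) ((γ ≫ 𝒜.unpack Γ gs) ≫ 𝒜.tm .unit) ∈ ℐ.rty (ℐ.rctx G) (.unit φ) :=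
    ⟨Set.mem_of_eq_of_mem (lift_fst _ _) hG, (ℐ.mem_fml_inst gs φ _ γ).1 h⟩
  rcases hφ with ⟨hψ, hφ⟩ | ⟨hψ, hφ⟩
  · exact Or.inl ⟨_, hmem φt hφ, hop.trans ((congrArg (lift _)
      (ht _ ((ℐ.mem_fml_rename hm ψt _).1 hψ))).trans (lift_unit_comp_whiskerLeft _ _ _).symm)⟩
  · exact Or.inr ⟨_, hmem φf hφ, hop.trans ((congrArg (lift _)
      (hf _ ((ℐ.mem_fml_rename hm ψf _).1 hψ))).trans (lift_unit_comp_whiskerLeft _ _ _).symm)⟩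

end LambdaHFL

theorem mainTheorem7 {C : Type u} [Category.{v} C] [CartesianMonoidalCategory C]
    [MonoidalClosed C] [HasBinaryCoproducts C] [HasInitial C] [LambdaHFL.OmegaBiCCC C]
    [LambdaHFL.AdmitsLifting C] {S : LambdaHFL.Signature.{w₁, w₂, w₃}}
    (𝒜 : LambdaHFL.Model C S) (ℐ : LambdaHFL.PredInterp 𝒜) :
    (LambdaHFL.RBasicConst (LambdaHFL.Valid ℐ) ∧
      LambdaHFL.RBasicSimp (LambdaHFL.Valid ℐ) ∧
      LambdaHFL.RBasicBool ℐ (LambdaHFL.Valid ℐ)) ∧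
    ∀ J : LambdaHFL.Judgement S, LambdaHFL.RBasicOp ℐ J →
      (LambdaHFL.RUnit J → LambdaHFL.RBasicConst J) ∧
      LambdaHFL.RBasicSimp J ∧
      LambdaHFL.RBasicBool ℐ J := by
  have h := LambdaHFL.valid_rBasicOp ℐ
  exact ⟨⟨h.rBasicConst (LambdaHFL.valid_rUnit ℐ), h.rBasicSimp, h.rBasicBool⟩,
    fun _ hJ => ⟨hJ.rBasicConst, hJ.rBasicSimp, hJ.rBasicBool⟩⟩
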